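/- Let $\kappa$ be a singular cardinal and $\lambda=\mathrm{cf}(\kappa)$. Definitions. $\kappa^+\cap\mathrm{cof}(\lambda^+)$ is the set of $\delta<\kappa^+$ with $\mathrm{cf}(\delta)=\lambda^+$. A set $S\subseteq\kappa^+$ belongs to $I[\kappa^+;\kappa]$ if there are a sequence $\langle a_\alpha:\alpha<\kappa^+\rangle$ of subsets of $\kappa^+$ of size $<\kappa$ and a closed unbounded $C\subseteq\kappa^+$ such that every $\delta\in C\cap S$ is a singular limit ordinal for which there is an unbounded $A\subseteq\delta$ of order type $\mathrm{cf}(\delta)$ such that for every $\alpha<\delta$ there is $\beta<\delta$ with $A\cap\alpha\subseteq a_\beta$. A function on $[\kappa^+]^2$ is $<\kappa$-bounded if each of its fibres has size $<\kappa$; a set $A\subseteq\kappa^+$ is rainbow for it if its restriction to $[A]^2$ is injective. The relation $\kappa^+\to^{poly}(\eta)^2_{<\kappa\text{-bdd}}$ says that every $<\kappa$-bounded $f:[\kappa^+]^2\to\kappa^+$ has a rainbow set of order type $\eta$. A function $d:[\kappa^+]^2\to\lambda$ is normal if $\sup_{\alpha<\kappa^+}|\{\beta<\alpha:d(\beta,\alpha)<i\}|<\kappa$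 for all $i<\lambda$; transitive if $d(\alpha,\beta)\le\max\{d(\alpha,\gamma),d(\gamma,\beta)\}$ for all $\alpha<\gamma<\beta<\kappa^+$; approachable on $S$ if every $\delta\in S$ has a cofinal subset $A\subseteq\delta$ such that $\sup\{d(\beta,\alpha):\beta\in A\cap\alpha\}<\lambda$ for all $\alpha\in A$. The principle $\square_\kappa$ says that there is a sequence $\langle C_\alpha:\alpha<\kappa^+\text{ limit}\rangle$ such that each $C_\alpha$ is closed and unbounded in $\alpha$ and of order type $\le\kappa$, and $C_\beta=C_\alpha\cap\beta$ whenever $\beta<\alpha$ is a limit point of $C_\alpha$. Lemma. (1) If $\kappa^+\cap\mathrm{cof}(\lambda^+)\in I[\kappa^+;\kappa]$, then $\kappa^+\not\to^{poly}(\lambda^+)^2_{<\kappa\text{-bdd}}$. Moreover, there are then a normal, transitive $d:[\kappa^+]^2\to\lambda$ and a closed unbounded $E\subseteq\kappa^+$ such that $d$ is approachable on $E\cap\mathrm{cof}(\lambda^+)$, and the coloring $\{\alpha,\beta\}\mapsto(d(\alpha,\beta),\beta)$ (for $\alpha<\beta<\kappa^+$) is $<\kappa$-bounded and has no rainbow subset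 $A\subseteq E$ of order type $\lambda^+$. (2) If $\square_\kappa$ holds, then $\kappa^+\cap\mathrm{cof}(\lambda^+)\in I[\kappa^+;\kappa]$, and hence $\kappa^+\not\to^{poly}(\lambda^+)^2_{<\kappa\text{-bdd}}$. -/

import Mathlib

open Cardinal Ordinal Order

universe u

/-! Throughout, an ordinal `o` is represented by its canonical well-ordered type `o.ToType`;
`[K]^n` is `Set.powersetCard K n`; and the ordinal `δ = {x | x < δ}` below a point `δ` of a
well-order is `Set.Iio δ`. -/

namespace Rainbow

section Partition

variable {X C : Type u}

/-- A coloring is `<μ`-bounded if every color class has size less than `μ`. -/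
def IsLTBounded (μ : Cardinal.{u}) (f : X → C) : Prop :=
  ∀ c : C, #(f ⁻¹' {c} : Set X) < μ

variable {K : Type u} {n : ℕ}

/-- `A` is a rainbow set for `f : [K]^n → C`: the restriction of `f` to `[A]^n` is injective. -/
def IsRainbow (f : Set.powersetCard K n → C) (A : Set K) : Prop :=
  Set.InjOn f {s | ((s : Finset K) : Set K) ⊆ A}

/-- The polychromatic partition relation `Λ →^{poly} (η)^n_{<μ-bdd}`: for every `<μ`-bounded
`f : [Λ]^n → Λ` there is a rainbow set `A ⊆ Λ` of order type `η`. -/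
def PolyArrowLT (Λ η : Ordinal.{u}) (n : ℕ) (μ : Cardinal.{u}) : Prop :=
  ∀ f : Set.powersetCard Λ.ToType n → Λ.ToType, IsLTBounded μ f →
    ∃ A : Set Λ.ToType, typeLT A = η ∧ IsRainbow f A

theorem nonempty_of_pair (s : Set.powersetCard K 2) : (s : Finset K).Nonempty := by
  have h : (s : Finset K).card = 2 := s.2
  exact Finset.card_pos.mp (by omega)

end Partition

section Wellorder

variable {K : Type u} [LinearOrder K] [WellFoundedLT K]

/-- The set of points of cofinality `c`; for `K = κ⁺` this is `κ⁺ ∩ cof(c)`. -/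
def cofSet (K : Type u) [LinearOrder K] (c : Cardinal.{u}) : Set K :=
  {δ | Order.cof (Set.Iio δ) = c}

/-- `A` is an unbounded (cofinal) subset of `δ`. -/
def UnboundedIn (A : Set K) (δ : K) : Prop :=
  A ⊆ Set.Iio δ ∧ ∀ x < δ, ∃ a ∈ A, x ≤ a

/-- `δ` is a singular limit ordinal: a limit with `cf(δ) < δ`. -/
def IsSingularPoint (δ : K) : Prop :=
  IsSuccLimit δ ∧ (Order.cof (Set.Iio δ)).ord < typeLT (Set.Iio δ)

/-- `δ` is weakly approachable with respect to the sequence `a`: there is an unbounded `A ⊆ δ`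
of order type `cf(δ)` every proper initial segment `A ∩ α` of which (`α < δ`) is covered by some
`a β` with `β < δ`. -/
def WeaklyApproachable (a : K → Set K) (δ : K) : Prop :=
  ∃ A : Set K, UnboundedIn A δ ∧ typeLT A = (Order.cof (Set.Iio δ)).ord ∧
    ∀ α < δ, ∃ β < δ, A ∩ Set.Iio α ⊆ a β

/-- `S ∈ I[K; κ]` (used with `K = κ⁺`): there are a sequence `⟨a_α : α ∈ K⟩` of subsets of `K` of
size `< κ` and a club `C` such that every `δ ∈ C ∩ S` is singular and weakly approachable with
respect to the sequence. -/
def MemApproachabilityIdeal (κ : Cardinal.{u}) (S : Set K) : Prop :=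
  ∃ (a : K → Set K) (C : Set K), (∀ α, #(a α) < κ) ∧ IsClub C ∧
    ∀ δ ∈ C ∩ S, IsSingularPoint δ ∧ WeaklyApproachable a δ

/-- `β` is a limit point of `S`: `β ≠ 0` and `S ∩ β` is unbounded in `β`, without a maximum. -/
def IsLimitPoint (S : Set K) (β : K) : Prop :=
  (Set.Iio β).Nonempty ∧ ∀ x < β, ∃ y ∈ S, x < y ∧ y < β

/-! A function `d : [K]^2 → I` is written as `d : K → K → I`; only the values `d β α` with
`β < α` are ever used. -/

variable {I : Type u} [LinearOrder I]

/-- `d` is normal: for each `i`, the supremum over `α` of `|{β < α : d(β, α) < i}|` is `< κ`. -/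
def IsNormalFun (κ : Cardinal.{u}) (d : K → K → I) : Prop :=
  ∀ i : I, (⨆ α : K, #{β : K | β < α ∧ d β α < i}) < κ

/-- `d` is transitive (subadditive). -/
def IsTransitiveFun (d : K → K → I) : Prop :=
  ∀ α γ β : K, α < γ → γ < β → d α β ≤ max (d α γ) (d γ β)

/-- `d` is approachable on `S`: every `δ ∈ S` has a cofinal `A ⊆ δ` such that for each `α ∈ A` the
values `d(β, α)`, `β ∈ A ∩ α`, are bounded in `I`. (For `I = cf(κ)`, a limit ordinal, this says
that their supremum is `< cf(κ)`.) -/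
def IsApproachableOn (d : K → K → I) (S : Set K) : Prop :=
  ∀ δ ∈ S, ∃ A : Set K, UnboundedIn A δ ∧
    ∀ α ∈ A, BddAbove ((fun β => d β α) '' (A ∩ Set.Iio α))

/-- The coloring `{α, β} ↦ (d(α, β), β)`, for `α < β`, of `[K]^2`. -/
def pairColoring (d : K → K → I) (s : Set.powersetCard K 2) : I × K :=
  (d ((s : Finset K).min' (nonempty_of_pair s)) ((s : Finset K).max' (nonempty_of_pair s)),
    (s : Finset K).max' (nonempty_of_pair s))

end Wellorder

/-- Jensen's principle `□_κ`: there is a sequence `⟨C_α : α < κ⁺ limit⟩` such that each `C_α` is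
closed and unbounded in `α`, has order type at most `κ`, and `C_β = C_α ∩ β` whenever `β < α` is a
limit point of `C_α`. -/
def SquarePrinciple (κ : Cardinal.{u}) : Prop :=
  ∃ C : (succ κ).ord.ToType → Set (succ κ).ord.ToType, ∀ α, IsSuccLimit α →
    UnboundedIn (C α) α ∧
    (∀ β < α, IsLimitPoint (C α) β → β ∈ C α) ∧
    typeLT (C α) ≤ κ.ord ∧
    ∀ β < α, IsLimitPoint (C α) β → C β = C α ∩ Set.Iio β

end Rainbow

namespace Rainbow

/-! ### Closure under relations, recursion and ranks -/

section General

variable {K : Type u}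

/-! Write `κ` as the union of `λ` increasing initial segments of size `< κ`. Level `i` lets each `β`
see the part of `β` enumerated by stage `i`, together with `a β` once that set is small enough. Let
`d(γ, α)` be the least level at which `γ` is joined to `α` by a chain below `α`. Level sets have
size bounded independently of `α`, chains concatenate, and initial segments covered by some `a β`
get bounded values, so `d` is normal, transitive and approachable
(`exists_isNormalFun_isTransitiveFun`, `exists_isApproachableOn`).

If `A ⊆ E` has type `λ⁺`, its supremum `δ` lies in `E` and has cofinality `λ⁺`. Transitivity through
an approachability witness at `δ` bounds `λ` many values `d(·, γ)` on `A` by one level below `λ`, so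
two coincide (`IsTransitiveFun.exists_eq`) and `A` is not rainbow. Enumerating `E` turns this into
the failure of the partition relation.

Under `□_κ`, the small `C_α` themselves witness approachability: coherence at limit points captures
initial segments of `C_δ`. -/

theorem mk_transGen_le {r : K → K → Prop} {c : Cardinal.{u}} (hc : ℵ₀ ≤ c)
    (h : ∀ y, #{x | r x y} ≤ c) (α : K) : #{x | Relation.TransGen r x α} ≤ c := by
  obtain ⟨S, hS₀, hS₁⟩ : ∃ S : ℕ → Set K, S 0 = {x | r x α} ∧
      ∀ n, S (n + 1) = ⋃ y ∈ S n, {x | r x y} :=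
    ⟨fun n => Nat.rec {x | r x α} (fun _ T => ⋃ y ∈ T, {x | r x y}) n, rfl, fun _ => rfl⟩
  have hS : ∀ n, #(S n) ≤ c := by
    intro n
    induction n with
    | zero => exact hS₀ ▸ h α
    | succ n ih =>
      rw [hS₁]
      exact (mk_biUnion_le _ (S n)).trans (mul_le_of_le hc ih (ciSup_le' fun y => h y.1))
  have hsub : {x | Relation.TransGen r x α} ⊆ ⋃ n : ULift.{u} ℕ, S n.down := by
    intro x hx
    rw [Set.mem_iUnion]
    induction hx using Relation.TransGen.head_induction_on with
    | single hx => exact ⟨⟨0⟩, by rwa [hS₀]⟩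
    | @head x y hxy _ ih =>
      obtain ⟨⟨n⟩, hn⟩ := ih
      refine ⟨⟨n + 1⟩, ?_⟩
      rw [hS₁]
      exact Set.mem_biUnion hn hxy
  refine (mk_le_mk_of_subset hsub).trans ((mk_iUnion_le _).trans ?_)
  exact mul_le_of_le hc (by simpa using hc) (ciSup_le' fun n => hS n.down)

variable [LinearOrder K] [WellFoundedLT K]

theorem exists_recursive_set (R : K → Set K → Prop) :
    ∃ S : Set K, ∀ α, α ∈ S ↔ R α (S ∩ Set.Iio α) := by
  let P : K → Prop := WellFoundedLT.fix fun α ih => R α {γ | ∃ h : γ < α, ih γ h}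
  refine ⟨{α | P α}, fun α => ?_⟩
  have h : P α = R α {γ | ∃ _ : γ < α, P γ} :=
    WellFoundedLT.fix_eq (fun α (ih : ∀ γ, γ < α → Prop) => R α {γ | ∃ h : γ < α, ih γ h}) α
  have h' : {γ | ∃ _ : γ < α, P γ} = {α | P α} ∩ Set.Iio α := by
    ext γ
    simp [and_comm]
  rw [Set.mem_ofPred_eq, h, h']

/-- A weakly approachable limit point has an unbounded subset each of whose proper initial
segments `A ∩ α`, with `α ∈ A`, is covered by a set of the sequence with index below `α`. -/
theorem WeaklyApproachable.exists_unboundedIn {a : K → Set K} {δ : K}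
    (h : WeaklyApproachable a δ) (hδ : IsSuccLimit δ) :
    ∃ A : Set K, UnboundedIn A δ ∧ ∀ α ∈ A, ∃ β < α, A ∩ Set.Iio α ⊆ a β := by
  obtain ⟨A, ⟨hAδ, hA⟩, -, ha⟩ := h
  -- Keep a point of `A` exactly when the points kept before it are covered by some earlier index.
  -- If `S` were bounded by `x`, one `a β` would cover all of it, and any point of `A` above both
  -- `x` and `β` would have been kept.
  obtain ⟨S, hS⟩ := exists_recursive_set fun α T => α ∈ A ∧ ∃ β < α, T ⊆ a β
  refine ⟨S, ⟨fun α hα => hAδ ((hS α).1 hα).1, fun x hx => ?_⟩, fun α hα => ((hS α).1 hα).2⟩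
  by_contra! hcon
  obtain ⟨β, hβ, hβa⟩ := ha x hx
  obtain ⟨y, hy, hxy⟩ := hδ.lt_iff_exists_lt.1 (max_lt hx hβ)
  obtain ⟨α, hα, hyα⟩ := hA y hy
  have hlt := hxy.trans_le hyα
  refine (hcon α ((hS α).2 ⟨hα, β, (le_max_right _ _).trans_lt hlt, fun γ hγ => ?_⟩)).not_gt
    ((le_max_left _ _).trans_lt hlt)
  exact hβa ⟨((hS γ).1 hγ.1).1, hcon γ hγ.1⟩

variable {I : Type u} [LinearOrder I] [WellFoundedLT I] [Nonempty I]

omit [WellFoundedLT K] in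
/-- A filtration of the initial segments of `K` is the family of sublevel sets of a function. -/
theorem exists_rank {B : K → I → Set K} (hmono : ∀ α, Monotone (B α))
    (hB : ∀ α, ∀ β < α, ∃ i, β ∈ B α i) :
    ∃ d : K → K → I, ∀ β α, β < α → ∀ i, d β α ≤ i ↔ β ∈ B α i := by
  have h (β α : K) : ∃ i, β < α → β ∈ B α i ∧ ∀ j, β ∈ B α j → i ≤ j := by
    by_cases hβα : β < α
    · obtain ⟨i, hi, hmin⟩ := wellFounded_lt.has_min {i | β ∈ B α i} (hB α β hβα)
      exact ⟨i, fun _ => ⟨hi, fun j hj => not_lt.1 (hmin j hj)⟩⟩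
    · exact ⟨Classical.arbitrary I, fun h => absurd h hβα⟩
  choose d hd using h
  exact ⟨d, fun β α hβα i => ⟨fun hi => hmono α hi (hd β α hβα).1, (hd β α hβα).2 i⟩⟩

end General

/-! ### Chains along a set mapping -/

section Reach

variable {K : Type u} [LinearOrder K]

/-- Those points that are connected to `α` by a chain below `α` along the set mapping `F`. -/
def reach (F : K → Set K) (α : K) : Set K :=
  {γ | Relation.TransGen (fun x y => x < α ∧ x ∈ F y) γ α}

theorem mk_reach_le {F : K → Set K} {c : Cardinal.{u}} (hc : ℵ₀ ≤ c) (hF : ∀ y, #(F y) ≤ c)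
    (α : K) : #(reach F α) ≤ c :=
  mk_transGen_le hc (fun y => (mk_le_mk_of_subset fun _ hx => hx.2).trans (hF y)) α

theorem reach_mono {F G : K → Set K} (h : ∀ y, F y ⊆ G y) (α : K) : reach F α ⊆ reach G α :=
  fun _ hγ => Relation.TransGen.mono (fun _ _ hx => ⟨hx.1, h _ hx.2⟩) _ _ hγ

theorem lt_of_mem_reach {F : K → Set K} {α γ : K} (h : γ ∈ reach F α) : γ < α := by
  cases h using Relation.TransGen.head_induction_on with
  | single h => exact h.1
  | head h => exact h.1

/-- Chains below `β` stay below `α` and can be concatenated; this is the source of transitivity. -/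
theorem reach_subset_reach {F : K → Set K} {α β : K} (h : β ∈ reach F α) :
    reach F β ⊆ reach F α :=
  fun _ hγ => Relation.TransGen.trans
    (Relation.TransGen.mono (fun _ _ hx => ⟨hx.1.trans (lt_of_mem_reach h), hx.2⟩) _ _ hγ) h

theorem mem_reach_self {F : K → Set K} {α γ : K} (h : γ ∈ F α) (hγ : γ < α) : γ ∈ reach F α :=
  Relation.TransGen.single ⟨hγ, h⟩

theorem mem_reach_of_mem {F : K → Set K} {α β γ : K} (h : β ∈ reach F α) (hγ : γ ∈ F β)
    (hγα : γ < α) : γ ∈ reach F α :=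
  Relation.TransGen.head ⟨hγα, hγ⟩ h

end Reach

/-! ### The normal transitive function -/

section Cofinality

variable {κ : Cardinal.{u}}

theorem mk_Iic_toType_lt (hκ : ℵ₀ ≤ κ) (x : κ.ord.ToType) : #(Set.Iic x) < κ := by
  have h : #(Set.Iio x) < κ := by simpa using mk_Iio_lt x
  rw [← Set.Iio_insert]
  exact (mk_insert_le).trans_lt (add_lt_of_lt hκ h (one_lt_aleph0.trans_le hκ))

theorem exists_mk_Iio_toType_eq {μ : Cardinal.{u}} (h : μ < κ) :
    ∃ x : κ.ord.ToType, #(Set.Iio x) = μ := by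
  obtain ⟨x, hx⟩ := typein_surj (α := κ.ord.ToType) (· < ·) (o := μ.ord) (by simpa using h)
  refine ⟨x, ?_⟩
  rw [← card_type (α := Set.Iio x) (· < ·), type_Iio_lt, hx, card_ord]

theorem exists_monotone_isCofinal_range (κ : Cardinal.{u}) :
    ∃ f : κ.ord.cof.ord.ToType → κ.ord.ToType, Monotone f ∧ ∀ x, ∃ i, x ≤ f i := by
  obtain ⟨s, hs, hs'⟩ := exists_ord_cof_eq κ.ord.ToType
  rw [cof_toType, ← type_toType κ.ord.cof.ord] at hs'
  obtain ⟨e⟩ := type_eq.1 hs'.symm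
  refine ⟨fun i => OrderIso.ofRelIsoLT e i,
    fun i j hij => (OrderIso.ofRelIsoLT e).monotone hij, fun x => ?_⟩
  obtain ⟨y, hy, hxy⟩ := hs x
  exact ⟨(OrderIso.ofRelIsoLT e).symm ⟨y, hy⟩, by simpa using hxy⟩

variable {a : (succ κ).ord.ToType → Set (succ κ).ord.ToType}

/-- For every sequence of small subsets of `κ⁺` there is a normal transitive function each of whose
sublevel sets absorbs, from some level on, the sets of the sequence with index in it. -/
theorem exists_isNormalFun_isTransitiveFun (hκ' : ℵ₀ < κ) (ha : ∀ α, #(a α) < κ) :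
    ∃ d : (succ κ).ord.ToType → (succ κ).ord.ToType → κ.ord.cof.ord.ToType,
      IsNormalFun κ d ∧ IsTransitiveFun d ∧
      ∀ β, ∃ i, ∀ α, β < α → ∀ γ ∈ a β, γ < α → d γ α ≤ max i (d β α) := by
  have hκ := hκ'.le
  obtain ⟨f, hfmono, hf⟩ := exists_monotone_isCofinal_range κ
  have he (β : (succ κ).ord.ToType) : Nonempty (Set.Iio β ↪ κ.ord.ToType) := by
    rw [← Cardinal.le_def, mk_ord_toType, ← lt_succ_iff]
    simpa using mk_Iio_lt β
  have e (β : (succ κ).ord.ToType) : Set.Iio β ↪ κ.ord.ToType := (he β).some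
  let c (i : κ.ord.cof.ord.ToType) : Cardinal.{u} := max ℵ₀ #(Set.Iic (f i))
  have hc i : c i < κ := max_lt hκ' (mk_Iic_toType_lt hκ _)
  have hcmono : Monotone c := fun i j hij =>
    max_le_max le_rfl (mk_le_mk_of_subset (Set.Iic_subset_Iic.2 (hfmono hij)))
  -- The first part eventually catches every point below `β`; the second adds `a β` only at levels
  -- where it respects the bound `c i`. Since `a β` may contain points above `β`, chains need not
  -- descend.
  let F (i : κ.ord.cof.ord.ToType) (β : (succ κ).ord.ToType) : Set (succ κ).ord.ToType :=
    (Subtype.val '' (e β ⁻¹' Set.Iic (f i))) ∪ {γ ∈ a β | #(a β) ≤ c i}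
  have hF i β : #(F i β) ≤ c i := by
    refine (mk_union_le _ _).trans ?_
    refine (add_le_add ?_ ?_).trans (add_eq_self (le_max_left ℵ₀ #(Set.Iic (f i)))).le
    · exact mk_image_le.trans
        ((mk_preimage_of_injective _ _ (e β).injective).trans (le_max_right _ _))
    · by_cases h : #(a β) ≤ c i
      · exact (mk_le_mk_of_subset fun _ hγ => hγ.1).trans h
      · simp [h]
  have hFmono i j (hij : i ≤ j) β : F i β ⊆ F j β := by
    refine Set.union_subset_union (Set.image_mono (Set.preimage_mono ?_)) ?_
    · exact Set.Iic_subset_Iic.2 (hfmono hij)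
    · exact fun γ hγ => ⟨hγ.1, hγ.2.trans (hcmono hij)⟩
  have : Nonempty κ.ord.cof.ord.ToType := by
    obtain ⟨x, -⟩ := exists_mk_Iio_toType_eq (aleph0_pos.trans_le hκ)
    exact ⟨(hf x).choose⟩
  obtain ⟨d, hd⟩ := exists_rank (B := fun α i => reach (F i) α)
    (fun α i j hij => reach_mono (hFmono i j hij) α) (fun α β hβ => by
      obtain ⟨i, hi⟩ := hf (e α ⟨β, hβ⟩)
      exact ⟨i, mem_reach_self (.inl ⟨⟨β, hβ⟩, hi, rfl⟩) hβ⟩)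
  refine ⟨d, fun i => ?_, fun α γ β hαγ hγβ => ?_, fun β => ?_⟩
  · refine (ciSup_le' fun α => ?_).trans_lt (hc i)
    exact (mk_le_mk_of_subset fun β hβ => (hd β α hβ.1 i).1 hβ.2.le).trans
      (mk_reach_le (le_max_left _ _) (hF i) α)
  · rw [hd α β (hαγ.trans hγβ)]
    exact reach_subset_reach ((hd γ β hγβ _).1 (le_max_right _ _))
      ((hd α γ hαγ _).1 (le_max_left _ _))
  -- Any level `i` with `x ≤ f i` has `#(a β) ≤ c i`, so from there on `a β` is part of `F i β`.
  · obtain ⟨x, hx⟩ := exists_mk_Iio_toType_eq (ha β)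
    obtain ⟨i, hi⟩ := hf x
    refine ⟨i, fun α hβα γ hγ hγα => (hd γ α hγα _).2 ?_⟩
    refine mem_reach_of_mem ((hd β α hβα _).1 (le_max_right _ _)) (.inr ⟨hγ, ?_⟩) hγα
    rw [← hx]
    refine (mk_le_mk_of_subset ?_).trans ((le_max_right _ _).trans (hcmono (le_max_left _ _)))
    exact fun y hy => (le_of_lt hy).trans hi

end Cofinality

/-! ### Unbounded subsets and cofinality -/

section Unbounded

variable {K : Type u} [LinearOrder K]

theorem UnboundedIn.isCofinal {A : Set K} {δ : K} (h : UnboundedIn A δ) :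
    IsCofinal (Subtype.val ⁻¹' A : Set (Set.Iio δ)) := by
  rintro ⟨x, hx⟩
  obtain ⟨a, ha, hxa⟩ := h.2 x hx
  exact ⟨⟨a, h.1 ha⟩, ha, hxa⟩

theorem UnboundedIn.exists_gt {A : Set K} {δ : K} (h : UnboundedIn A δ)
    (hδ : ℵ₀ ≤ Order.cof (Set.Iio δ)) {x : K} (hx : x < δ) : ∃ a ∈ A, x < a := by
  have : Nonempty (Set.Iio δ) := ⟨⟨x, hx⟩⟩
  have : NoTopOrder (Set.Iio δ) := one_lt_cof_iff.1 (aleph0_le_cof_iff.1 hδ)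
  obtain ⟨⟨y, hy⟩, hxy⟩ := NoTopOrder.exists_not_le (⟨x, hx⟩ : Set.Iio δ)
  obtain ⟨a, ha, hya⟩ := h.2 y hy
  exact ⟨a, ha, lt_of_lt_of_le (not_le.1 hxy) hya⟩

theorem isSuccLimit_of_aleph0_le_cof {δ : K} (hδ : ℵ₀ ≤ Order.cof (Set.Iio δ)) :
    IsSuccLimit δ := by
  refine ⟨fun hmin => ?_, fun x hx => ?_⟩
  · have : IsEmpty (Set.Iio δ) := ⟨fun x => hmin.not_lt x.2⟩
    rw [Order.cof_eq_zero] at hδ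
    exact absurd hδ aleph0_pos.not_ge
  · obtain ⟨y, hy, hxy⟩ := UnboundedIn.exists_gt (A := Set.Iio δ)
      ⟨le_rfl, fun x hx => ⟨x, hx, le_rfl⟩⟩ hδ hx.lt
    exact hx.2 hxy hy

variable [WellFoundedLT K]

theorem UnboundedIn.cof_typeLT {A : Set K} {δ : K} (h : UnboundedIn A δ) :
    (typeLT A).cof = Order.cof (Set.Iio δ) := by
  rw [cof_type]
  refine cof_congr_of_strictMono (f := fun a : A => ⟨a, h.1 a.2⟩) (fun _ _ h => h) ?_
  rintro ⟨x, hx⟩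
  obtain ⟨a, ha, hxa⟩ := h.2 x hx
  exact ⟨_, ⟨⟨a, ha⟩, rfl⟩, hxa⟩

theorem exists_unboundedIn {A : Set K} (hA : ¬ IsCofinal A) : ∃ δ, UnboundedIn A δ := by
  obtain ⟨δ, hδ, hmin⟩ := wellFounded_lt.has_min {x | ∀ a ∈ A, a < x} (not_isCofinal_iff.1 hA)
  refine ⟨δ, hδ, fun x hx => ?_⟩
  by_contra! h
  exact hmin x h hx

theorem exists_least_gt {A : Set K} {x : K} (h : ∃ a ∈ A, x < a) :
    ∃ a ∈ A, x < a ∧ ∀ b ∈ A, x < b → a ≤ b := by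
  obtain ⟨a, ha, hmin⟩ := wellFounded_lt.has_min {a ∈ A | x < a} h
  exact ⟨a, ha.1, ha.2, fun b hb hxb => not_lt.1 (hmin b ⟨hb, hxb⟩)⟩

end Unbounded

/-! ### The pigeonhole argument at cofinality `λ⁺` -/

section Transitive

variable {K : Type u} [LinearOrder K] [WellFoundedLT K] {lam : Cardinal.{u}}

/-- If `d` is transitive and approachable at `δ` of cofinality `λ⁺`, then the values `d(·, γ)`
cannot be pairwise distinct on `A ∩ γ` for all `γ` in an unbounded subset `A` of `δ`. -/
theorem IsTransitiveFun.exists_eq (hlam : ℵ₀ ≤ lam) {d : K → K → lam.ord.ToType}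
    (hd : IsTransitiveFun d) {δ : K} (hδ : Order.cof (Set.Iio δ) = succ lam) {A T : Set K}
    (hA : UnboundedIn A δ) (hT : UnboundedIn T δ)
    (hTd : ∀ α ∈ T, BddAbove ((fun β => d β α) '' (T ∩ Set.Iio α))) :
    ∃ α ∈ A, ∃ β ∈ A, ∃ γ ∈ A, α < β ∧ β < γ ∧ d α γ = d β γ := by
  have hδ' : ℵ₀ ≤ Order.cof (Set.Iio δ) := hδ ▸ hlam.trans (le_succ lam)
  choose b hbA hb using fun x : Set.Iio δ => hA.exists_gt hδ' x.2
  choose s hsT hs hsmin using fun x : Set.Iio δ => exists_least_gt (hT.exists_gt hδ' x.2)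
  let b' (x : Set.Iio δ) : Set.Iio δ := ⟨b x, hA.1 (hbA x)⟩
  -- From `x ∈ T` pass to `b x ∈ A` above it, then to the next point of `T`. Recording both values
  -- of `d` uses only `λ` labels, so one label recurs cofinally in `δ`.
  let X (p : lam.ord.ToType × lam.ord.ToType) : Set (Set.Iio δ) :=
    {x | x.1 ∈ T ∧ d x (b x) = p.1 ∧ d (b x) (s (b' x)) = p.2}
  obtain ⟨⟨i, j⟩, hX⟩ : ∃ p, IsCofinal (X p) := by
    refine isCofinal_of_isCofinal_iUnion (hT.isCofinal.mono fun x hx => ?_) ?_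
    · exact Set.mem_iUnion.2 ⟨(d x (b x), d (b x) (s (b' x))), hx, rfl, rfl⟩
    · rw [mk_prod, Cardinal.lift_id, mk_ord_toType, mul_eq_self hlam, hδ]
      exact lt_succ lam
  have hbX : IsCofinal (b' '' X (i, j)) := fun x => by
    obtain ⟨y, hy, hxy⟩ := hX x
    exact ⟨b' y, ⟨y, hy, rfl⟩, hxy.trans (hb y).le⟩
  -- Only `λ` points are taken: few enough to be bounded in `δ`, too many for distinct values in a
  -- proper initial segment of `λ`.
  obtain ⟨Y, hYX, hY⟩ := le_mk_iff_exists_subset.1 ((le_succ lam).trans (hδ ▸ cof_le hbX))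
  have hYcof : ¬ IsCofinal Y := fun h => by
    have := cof_le h
    rw [hδ, hY] at this
    exact (lt_succ lam).not_ge this
  obtain ⟨z, hz⟩ := not_isCofinal_iff.1 hYcof
  obtain ⟨η, hη, hzη⟩ := hX z
  obtain ⟨k, hk⟩ := hTd η hη.1
  -- Follow `b ξ`, the next point of `T`, `η`, `b η`: the three steps cost at most `j`, `k` and `i`,
  -- and the middle one may be absent.
  have hbound (y : Set.Iio δ) (hy : y ∈ Y) : d y (b η) ≤ max (max j k) i := by
    obtain ⟨ξ, hξ, rfl⟩ := hYX hy
    have hlt : b ξ < η.1 := (hz _ hy).trans_le hzη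
    refine (hd (b ξ) η (b η) hlt (hb η)).trans (max_le_max ?_ hη.2.1.le)
    obtain heq | hlt' := (hsmin (b' ξ) η hη.1 hlt).eq_or_lt
    · rw [← heq]
      exact hξ.2.2.le.trans (le_max_left _ _)
    · exact (hd (b ξ) (s (b' ξ)) η (hs (b' ξ)) hlt').trans
        (max_le_max hξ.2.2.le (hk ⟨_, ⟨hsT _, hlt'⟩, rfl⟩))
  obtain ⟨x, y, hxy, heq⟩ : ∃ x y : Y, x.1 < y.1 ∧ d x.1 (b η) = d y.1 (b η) := by
    by_contra! hne
    let g (y : Y) : Set.Iic (max (max j k) i) := ⟨d y.1 (b η), hbound y.1 y.2⟩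
    have hg : Function.Injective g := fun x y hxy => by
      have hxy' : d x.1 (b η) = d y.1 (b η) := congrArg Subtype.val hxy
      obtain h | h | h := lt_trichotomy x.1 y.1
      · exact absurd hxy' (hne x y h)
      · exact Subtype.ext h
      · exact absurd hxy'.symm (hne y x h)
    exact (hY ▸ mk_le_of_injective hg).not_gt (mk_Iic_toType_lt hlam _)
  have hYA (y : Y) : (y.1 : K) ∈ A := by
    obtain ⟨ξ, -, h⟩ := hYX y.2
    rw [← h]
    exact hbA ξ
  exact ⟨x.1, hYA x, y.1, hYA y, b η, hbA η, hxy, lt_trans (lt_of_lt_of_le (hz _ y.2) hzη) (hb η), heq⟩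

end Transitive

/-! ### Pairs and the coloring -/

section Pairs

variable {K : Type u} [LinearOrder K]

/-- The two-element set `{α, β}`. -/
def pair {α β : K} (h : α < β) : Set.powersetCard K 2 :=
  ⟨{α, β}, Finset.card_pair h.ne⟩

theorem exists_eq_pair (s : Set.powersetCard K 2) : ∃ (α β : K) (h : α < β), s = pair h := by
  obtain ⟨s, hs⟩ := s
  obtain ⟨x, y, hxy, rfl⟩ := Finset.card_eq_two.1 hs
  obtain h | h := hxy.lt_or_gt
  · exact ⟨x, y, h, rfl⟩
  · exact ⟨y, x, h, Subtype.ext (Finset.pair_comm x y)⟩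

theorem coe_pair {α β : K} (h : α < β) : ((pair h : Finset K) : Set K) = {α, β} :=
  Finset.coe_pair

theorem map_pair {L : Type u} [LinearOrder L] (e : K ↪o L) {α β : K} (h : α < β) :
    Set.powersetCard.map 2 e.toEmbedding (pair h) = pair (e.lt_iff_lt.2 h) :=
  Subtype.ext (Finset.map_insert _ _ _)

theorem pair_injective_left {α α' β β' : K} {h : α < β} {h' : α' < β'} (heq : pair h = pair h') :
    α = α' := by
  have hset := congrArg (fun s : Set.powersetCard K 2 => ((s : Finset K) : Set K)) heq
  simp only [coe_pair] at hset
  obtain h | ⟨rfl, rfl⟩ := Set.pair_eq_pair_iff.1 hset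
  · exact h.1
  · exact absurd h' h.not_gt

variable {I : Type u}

theorem pairColoring_pair (d : K → K → I) {α β : K} (h : α < β) :
    pairColoring d (pair h) = (d α β, β) := by
  have hmin : (pair h : Finset K).min' (nonempty_of_pair _) = α := by
    simp [pair, h.le]
  have hmax : (pair h : Finset K).max' (nonempty_of_pair _) = β := by
    simp [pair, h.le]
  rw [pairColoring, hmin, hmax]

variable [LinearOrder I]

theorem IsNormalFun.isLTBounded_pairColoring {κ : Cardinal.{u}} {d : K → K → I} [NoMaxOrder I]
    (hd : IsNormalFun κ d) : IsLTBounded κ (pairColoring d) := by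
  rintro ⟨i, β⟩
  -- Normality bounds strict sublevel sets, so the fibre at `i` needs a larger level `j`.
  obtain ⟨j, hij⟩ := exists_gt i
  choose l r hlr hpair using exists_eq_pair (K := K)
  have h (s) (hs : s ∈ pairColoring d ⁻¹' {(i, β)}) :
      l s < β ∧ d (l s) β = i ∧ r s = β := by
    rw [Set.mem_preimage, hpair s, pairColoring_pair] at hs
    obtain ⟨h₁, h₂⟩ := Prod.ext_iff.1 hs
    simp only at h₁ h₂
    exact ⟨h₂ ▸ hlr s, h₂ ▸ h₁, h₂⟩
  refine (mk_le_of_injective (β := {γ : K | γ < β ∧ d γ β < j})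
    (f := fun s => ⟨l s.1, ?_⟩) fun s t hst => ?_).trans_lt
    ((le_ciSup Cardinal.bddAbove_of_small β).trans_lt (hd j))
  · exact ⟨(h s.1 s.2).1, (h s.1 s.2).2.1.trans_lt hij⟩
  · have h₁ : l s.1 = l t.1 := congrArg Subtype.val hst
    have h₂ : r s.1 = r t.1 := (h s.1 s.2).2.2.trans (h t.1 t.2).2.2.symm
    refine Subtype.ext ?_
    rw [hpair s.1, hpair t.1]
    congr 1

variable [WellFoundedLT K]

theorem not_isRainbow_pairColoring {lam : Cardinal.{u}} (hlam : ℵ₀ ≤ lam)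
    {d : K → K → lam.ord.ToType} (hd : IsTransitiveFun d) {E : Set K} (hE : IsClub E)
    (hdE : IsApproachableOn d (E ∩ cofSet K (succ lam))) (hK : succ lam < Order.cof K)
    {A : Set K} (hAE : A ⊆ E) (hA : typeLT A = (succ lam).ord) :
    ¬ IsRainbow (pairColoring d) A := by
  have hmk : #A = succ lam := by rw [← card_type (α := A) (· < ·), hA, card_ord]
  obtain ⟨δ, hδA⟩ := exists_unboundedIn fun h : IsCofinal A => (hmk ▸ cof_le h).not_gt hK
  have hδ : Order.cof (Set.Iio δ) = succ lam := by
    rw [← hδA.cof_typeLT, hA, (isRegular_succ hlam).cof_ord]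
  have hδ' : ℵ₀ ≤ Order.cof (Set.Iio δ) := hδ ▸ hlam.trans (le_succ lam)
  have hne : A.Nonempty := by
    rw [← Set.nonempty_coe_sort, ← mk_ne_zero_iff, hmk]
    exact (succ_pos lam).ne'
  have hδE : δ ∈ E := hE.isLUB_mem hAE hne ⟨fun a ha => (hδA.1 ha).le, fun y hy => by
    by_contra! h
    obtain ⟨a, ha, hya⟩ := hδA.exists_gt hδ' h
    exact (hy ha).not_gt hya⟩
  obtain ⟨T, hT, hTd⟩ := hdE δ ⟨hδE, hδ⟩
  obtain ⟨α, hα, β, hβ, γ, hγ, hαβ, hβγ, heq⟩ := hd.exists_eq hlam hδ hδA hT hTd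
  intro hrainbow
  refine hαβ.ne (pair_injective_left (h := hαβ.trans hβγ) (h' := hβγ) (hrainbow ?_ ?_ ?_))
  · rw [Set.mem_ofPred_eq, coe_pair]
    exact Set.pair_subset hα hγ
  · rw [Set.mem_ofPred_eq, coe_pair]
    exact Set.pair_subset hβ hγ
  · rw [pairColoring_pair, pairColoring_pair, heq]

end Pairs

/-! ### Pulling colorings back along order embeddings -/

section Transfer

variable {K L C D : Type u} [LinearOrder K] [LinearOrder L]

/-- A bounded coloring of the pairs of `L` without a rainbow subset of the range of `e : K ↪o L`
of order type `η` yields such a coloring of the pairs of `K`. -/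
theorem exists_isLTBounded_of_orderEmbedding [WellFoundedLT K] [WellFoundedLT L]
    {μ : Cardinal.{u}} (hμ : 0 < μ) (e : K ↪o L) (g : C ↪ D)
    {c : Set.powersetCard L 2 → C} (hc : IsLTBounded μ c) {η : Ordinal.{u}}
    (hη : ∀ A ⊆ Set.range e, typeLT A = η → ¬ IsRainbow c A) :
    ∃ f : Set.powersetCard K 2 → D, IsLTBounded μ f ∧
      ∀ A : Set K, typeLT A = η → ¬ IsRainbow f A := by
  have hinj : Function.Injective (Set.powersetCard.map 2 e.toEmbedding) := fun s t hst =>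
    Subtype.ext (Finset.map_injective e.toEmbedding (congrArg Subtype.val hst))
  refine ⟨fun s => g (c (Set.powersetCard.map 2 e.toEmbedding s)), fun y => ?_, fun A hA hf => ?_⟩
  · by_cases hy : y ∈ Set.range g
    · obtain ⟨x, rfl⟩ := hy
      refine lt_of_le_of_lt ?_ (hc x)
      refine (mk_le_mk_of_subset fun s hs => ?_).trans (mk_preimage_of_injective _ _ hinj)
      exact g.injective hs
    · have : IsEmpty ((fun s => g (c (Set.powersetCard.map 2 e.toEmbedding s))) ⁻¹' {y}) :=
        ⟨fun s => hy ⟨_, s.2⟩⟩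
      rwa [mk_eq_zero]
  · have htype : typeLT (e '' A) = η := by
      rw [← hA, type_eq]
      exact ⟨((e.strictMono.strictMonoOn A).orderIso e A).symm.toRelIsoLT⟩
    have hlift (s : Set.powersetCard L 2) (hs : ((s : Finset L) : Set L) ⊆ e '' A) :
        ∃ t : Set.powersetCard K 2, ((t : Finset K) : Set K) ⊆ A ∧
          Set.powersetCard.map 2 e.toEmbedding t = s := by
      obtain ⟨α, β, h, rfl⟩ := exists_eq_pair s
      rw [coe_pair, Set.pair_subset_iff] at hs
      obtain ⟨⟨α, hα, rfl⟩, ⟨β, hβ, rfl⟩⟩ := hs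
      refine ⟨pair (e.lt_iff_lt.1 h), ?_, map_pair e _⟩
      rw [coe_pair]
      exact Set.pair_subset hα hβ
    refine hη _ (Set.image_subset_range e A) htype fun s hs t ht hst => ?_
    obtain ⟨s', hs', rfl⟩ := hlift s hs
    obtain ⟨t', ht', rfl⟩ := hlift t ht
    rw [hf hs' ht' (congrArg g hst)]

end Transfer

/-! ### Singular cardinals, the partition relation and square -/

variable {κ lam : Cardinal.{u}}

theorem succ_lt_of_isSingular (hκ : κ.IsSingular) (hlam : κ.ord.cof = lam) : succ lam < κ :=
  hκ.isSuccLimit.succ_lt (hlam ▸ hκ.cof_ord_lt)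

theorem aleph0_le_of_isSingular (hκ : κ.IsSingular) (hlam : κ.ord.cof = lam) : ℵ₀ ≤ lam := by
  rw [← hlam, aleph0_le_cof_iff, one_lt_cof_iff]
  exact isSuccLimit_ord hκ.aleph0_le

theorem aleph0_lt_of_isSingular (hκ : κ.IsSingular) : ℵ₀ < κ :=
  (aleph0_le_of_isSingular hκ rfl).trans_lt hκ.cof_ord_lt

theorem cof_succ_ord_toType (hκ : ℵ₀ ≤ κ) : Order.cof (succ κ).ord.ToType = succ κ := by
  rw [cof_toType, (isRegular_succ hκ).cof_ord]

theorem exists_isApproachableOn (hκ : κ.IsSingular) (hlam : κ.ord.cof = lam)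
    (h : MemApproachabilityIdeal κ (cofSet (succ κ).ord.ToType (succ lam))) :
    ∃ (d : (succ κ).ord.ToType → (succ κ).ord.ToType → lam.ord.ToType)
      (E : Set (succ κ).ord.ToType), IsNormalFun κ d ∧ IsTransitiveFun d ∧ IsClub E ∧
      IsApproachableOn d (E ∩ cofSet (succ κ).ord.ToType (succ lam)) := by
  subst hlam
  obtain ⟨a, E, ha, hE, haE⟩ := h
  obtain ⟨d, hd, hdt, hda⟩ :=
    exists_isNormalFun_isTransitiveFun (aleph0_lt_of_isSingular hκ) ha
  refine ⟨d, E, hd, hdt, hE, fun δ hδ => ?_⟩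
  obtain ⟨hδsing, hδa⟩ := haE δ hδ
  obtain ⟨A, hA, hAa⟩ := hδa.exists_unboundedIn hδsing.1
  refine ⟨A, hA, fun α hα => ?_⟩
  obtain ⟨β, hβα, hβ⟩ := hAa α hα
  obtain ⟨i, hi⟩ := hda β
  refine ⟨max i (d β α), ?_⟩
  rintro _ ⟨γ, hγ, rfl⟩
  exact hi α hβα γ (hβ hγ) hγ.2

theorem not_polyArrowLT (hκ : κ.IsSingular) (hlam : κ.ord.cof = lam)
    {c : Set.powersetCard (succ κ).ord.ToType 2 → lam.ord.ToType × (succ κ).ord.ToType}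
    (hc : IsLTBounded κ c) {E : Set (succ κ).ord.ToType} (hE : IsCofinal E) {η : Ordinal.{u}}
    (hη : ∀ A ⊆ E, typeLT A = η → ¬ IsRainbow c A) :
    ¬ PolyArrowLT (succ κ).ord η 2 κ := by
  have hreg : IsRegularCardinalOrder (succ κ).ord.ToType :=
    ⟨by rw [cof_succ_ord_toType hκ.aleph0_le, type_toType]⟩
  have hg : #(lam.ord.ToType × (succ κ).ord.ToType) ≤ #(succ κ).ord.ToType := by
    rw [mk_prod, Cardinal.lift_id, Cardinal.lift_id, mk_ord_toType, mk_ord_toType]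
    exact mul_le_of_le (hκ.aleph0_le.trans (le_succ κ))
      ((hlam ▸ hκ.cof_ord_lt).le.trans (le_succ κ)) le_rfl
  obtain ⟨g⟩ := (Cardinal.le_def _ _).1 hg
  -- The increasing enumeration of `E`: every pulled-back set lands inside `E`, where rainbow sets
  -- are excluded.
  let e : (succ κ).ord.ToType ↪o (succ κ).ord.ToType :=
    (Order.enum E hE).toOrderEmbedding.trans (OrderEmbedding.subtype _)
  have he : Set.range e ⊆ E := by
    rintro _ ⟨x, rfl⟩
    exact (Order.enum E hE x).2
  obtain ⟨f, hf, hfη⟩ := exists_isLTBounded_of_orderEmbedding hκ.pos e g hc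
    fun A hA => hη A (hA.trans he)
  intro hpoly
  obtain ⟨A, hA, hAf⟩ := hpoly f hf
  exact hfη A hA hAf

theorem isClub_Ici {K : Type u} [LinearOrder K] (x : K) : IsClub (Set.Ici x) := by
  refine ⟨fun s hs hne _ y hy => ?_, fun y => ⟨max x y, le_max_left _ _, le_max_right _ _⟩⟩
  obtain ⟨z, hz⟩ := hne
  exact (hs hz).trans (hy.1 hz)

/-- An unbounded subset of a point of uncountable cofinality has arbitrarily large limit points. -/
theorem UnboundedIn.exists_isLimitPoint {K : Type u} [LinearOrder K] [WellFoundedLT K]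
    {A : Set K} {δ : K} (hA : UnboundedIn A δ) (hδ : ℵ₀ < Order.cof (Set.Iio δ))
    {α : K} (hα : α < δ) : ∃ γ < δ, α < γ ∧ IsLimitPoint A γ := by
  choose b hbA hb using fun x : Set.Iio δ => hA.exists_gt hδ.le x.2
  -- Climb through `A` in `ω` steps; uncountable cofinality keeps the supremum below `δ`.
  obtain ⟨x, hx₀, hx₁⟩ : ∃ x : ℕ → Set.Iio δ, x 0 = ⟨α, hα⟩ ∧ ∀ n, (x (n + 1)).1 = b (x n) :=
    ⟨fun n => Nat.rec ⟨α, hα⟩ (fun _ y => ⟨b y, hA.1 (hbA y)⟩) n, rfl, fun _ => rfl⟩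
  have hrange : ¬ IsCofinal (Set.range x) := fun h =>
    ((cof_le h).trans (le_aleph0_iff_set_countable.2 (Set.countable_range x))).not_gt hδ
  obtain ⟨γ, hγ, hmin⟩ := wellFounded_lt.has_min {z | ∀ y ∈ Set.range x, y < z}
    (not_isCofinal_iff.1 hrange)
  have hαγ : α < γ := by
    have := hγ _ ⟨0, rfl⟩
    rwa [hx₀] at this
  refine ⟨γ, γ.2, hαγ, ⟨α, hαγ⟩, fun y hy => ?_⟩
  have hy' := fun h => hmin ⟨y, hy.trans γ.2⟩ h hy
  simp only [Set.mem_ofPred_eq, Set.forall_mem_range] at hy'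
  obtain ⟨n, hn⟩ := not_forall.1 hy'
  replace hn := not_lt.1 hn
  refine ⟨x (n + 1), hx₁ n ▸ hbA _, lt_of_le_of_lt hn ?_, hγ _ ⟨n + 1, rfl⟩⟩
  rw [hx₁]
  exact hb _

theorem SquarePrinciple.memApproachabilityIdeal (hκ : κ.IsSingular) (hlam : κ.ord.cof = lam)
    (h : SquarePrinciple κ) :
    MemApproachabilityIdeal κ (cofSet (succ κ).ord.ToType (succ lam)) := by
  obtain ⟨C, hC⟩ := h
  obtain ⟨x, hx⟩ := exists_mk_Iio_toType_eq (lt_succ κ)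
  -- Large `C α` are replaced by `∅`. The club starts at a point with `κ` predecessors, so `λ⁺ < κ`
  -- makes every relevant `δ` singular.
  refine ⟨fun α => {y ∈ C α | #(C α) < κ}, Set.Ici x, fun α => ?_, isClub_Ici x, ?_⟩
  · by_cases h : #(C α) < κ
    · exact (mk_le_mk_of_subset fun _ hy => hy.1).trans_lt h
    · simpa [h] using hκ.pos
  rintro δ ⟨hxδ, hδ⟩
  rw [cofSet, Set.mem_ofPred_eq] at hδ
  have hδ' : ℵ₀ < Order.cof (Set.Iio δ) :=
    hδ ▸ (aleph0_le_of_isSingular hκ hlam).trans_lt (lt_succ lam)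
  have hlim := isSuccLimit_of_aleph0_le_cof hδ'.le
  obtain ⟨hCδ, -, hCκ, hCcoh⟩ := hC δ hlim
  refine ⟨⟨hlim, ?_⟩, ?_⟩
  · rw [hδ]
    refine (ord_lt_ord.2 (succ_lt_of_isSingular hκ hlam)).trans_le ?_
    rw [ord_le, card_type]
    exact hx.ge.trans (mk_le_mk_of_subset (Set.Iio_subset_Iio hxδ))
  have hsmall : #(C δ) < κ := by
    rw [← card_type (α := C δ) (· < ·), ← lt_ord]
    -- Order type `κ` would give `δ` cofinality `λ` instead of `λ⁺`.
    refine hCκ.lt_of_ne fun heq => ?_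
    have := hCδ.cof_typeLT
    rw [heq, hlam, hδ] at this
    exact (lt_succ lam).ne this
  obtain ⟨T, hT, hTcof, hTtype⟩ := exists_ord_cof_eq_of_isCofinal hCδ.isCofinal
  refine ⟨Subtype.val '' T, ⟨?_, fun y hy => ?_⟩, ?_, fun α hα => ?_⟩
  · rintro _ ⟨y, -, rfl⟩
    exact y.2
  · obtain ⟨z, hz, hyz⟩ := hTcof ⟨y, hy⟩
    exact ⟨z, ⟨z, hz, rfl⟩, hyz⟩
  · rw [← hTtype, type_eq]
    exact ⟨((Subtype.strictMono_coe _).strictMonoOn T).orderIso _ _ |>.symm.toRelIsoLT⟩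
  · obtain ⟨γ, hγδ, hαγ, hγ⟩ := hCδ.exists_isLimitPoint hδ' hα
    refine ⟨γ, hγδ, ?_⟩
    have hCγ := hCcoh γ hγδ hγ
    have hCγκ : #(C γ) < κ :=
      (mk_le_mk_of_subset (hCγ ▸ Set.inter_subset_left)).trans_lt hsmall
    rintro _ ⟨⟨y, hy, rfl⟩, hyα⟩
    exact ⟨hCγ ▸ ⟨hT hy, lt_trans hyα hαγ⟩, hCγκ⟩

end Rainbow

theorem mainTheorem4 (κ lam : Cardinal.{u}) (hκ : κ.IsSingular) (hlam : κ.ord.cof = lam) :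
    (Rainbow.MemApproachabilityIdeal κ (Rainbow.cofSet (succ κ).ord.ToType (succ lam)) →
      ¬ Rainbow.PolyArrowLT (succ κ).ord (succ lam).ord 2 κ ∧
      ∃ (d : (succ κ).ord.ToType → (succ κ).ord.ToType → lam.ord.ToType)
        (E : Set (succ κ).ord.ToType),
        Rainbow.IsNormalFun κ d ∧ Rainbow.IsTransitiveFun d ∧ IsClub E ∧
        Rainbow.IsApproachableOn d (E ∩ Rainbow.cofSet (succ κ).ord.ToType (succ lam)) ∧
        Rainbow.IsLTBounded κ (Rainbow.pairColoring d) ∧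
        ∀ A ⊆ E, typeLT A = (succ lam).ord → ¬ Rainbow.IsRainbow (Rainbow.pairColoring d) A) ∧
    (Rainbow.SquarePrinciple κ →
      Rainbow.MemApproachabilityIdeal κ (Rainbow.cofSet (succ κ).ord.ToType (succ lam)) ∧
      ¬ Rainbow.PolyArrowLT (succ κ).ord (succ lam).ord 2 κ) := by
  have hlam' := Rainbow.aleph0_le_of_isSingular hκ hlam
  have hnomax := Cardinal.noMaxOrder hlam'
  have hcof : succ lam < Order.cof (succ κ).ord.ToType := by
    rw [Rainbow.cof_succ_ord_toType hκ.aleph0_le]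
    exact (Rainbow.succ_lt_of_isSingular hκ hlam).trans (lt_succ κ)
  have key (hI : Rainbow.MemApproachabilityIdeal κ
      (Rainbow.cofSet (succ κ).ord.ToType (succ lam))) :=
    Rainbow.exists_isApproachableOn hκ hlam hI
  have hb {d : (succ κ).ord.ToType → (succ κ).ord.ToType → lam.ord.ToType}
      (hd : Rainbow.IsNormalFun κ d) := hd.isLTBounded_pairColoring
  have hpoly (hI : Rainbow.MemApproachabilityIdeal κ
      (Rainbow.cofSet (succ κ).ord.ToType (succ lam))) :
      ¬ Rainbow.PolyArrowLT (succ κ).ord (succ lam).ord 2 κ := by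
    obtain ⟨d, E, hd, hdt, hE, hda⟩ := key hI
    exact Rainbow.not_polyArrowLT hκ hlam (hb hd) hE.isCofinal
      fun A => Rainbow.not_isRainbow_pairColoring hlam' hdt hE hda hcof
  refine ⟨fun hI => ⟨hpoly hI, ?_⟩, fun hsq => ?_⟩
  · obtain ⟨d, E, hd, hdt, hE, hda⟩ := key hI
    exact ⟨d, E, hd, hdt, hE, hda, hb hd,
      fun A => Rainbow.not_isRainbow_pairColoring hlam' hdt hE hda hcof⟩
  · have hI := hsq.memApproachabilityIdeal hκ hlam
    exact ⟨hI, hpoly hI⟩
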